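/- A source generates new versions of its information (version number increased by $1$) according to a Poisson process of rate $\lambda_e>0$. There are $n=mk$ end-nodes ($m,k\ge 1$), divided into $m$ clusters of $k$ nodes, each cluster with a clusterhead (CH). The source sends its current version to the $m$ CHs with total rate $\lambda_s\ge 0$, each CH sends its version to its $k$ nodes with total rate $\lambda_c\ge 0$, and the nodes of a cluster gossip among themselves (fully connected cluster), each with total rate $\lambda_g\ge 0$. A receiver keeps the newer of its own and the received version. A CH or node is fresh if it holds the current version of the source, and stale otherwise. All versions together form a continuous-time Markov jump process in which the updates occur at the following rates. * Source to CHs. $DC_{\mathrm{noRC}}$: rate $\lambda_s/m$ to each CH. $DC_{\mathrm{RC}}$: rate $\lambda_s/(\text{number of stale CHs})$ to each stale CH and $0$ to fresh CHs. * Inside a cluster. $FC_{\mathrm{noRC}}$: rate $\lambda_c/k$ from the CH to each of its nodes, and rate $\lambda_g/(k-1)$ from each node to each other node of the cluster. $FC_{\mathrm{allRC}}$: if the cluster has $u\geq 1$ stale nodes, each stale node is sent updates by the CH at rate $\lambda_c/u$ and by each fresh node of the cluster at rate $\lambda_g/u$; there are no other updates inside the cluster. Initially the versions are arbitrary non-negative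 integers such that no node holds a newer version than its CH and no CH a newer version than the source. For an end-node $i$ let $F_i(t)\in\{0,1\}$ indicate that node $i$ is fresh at time $t$, and let $$\overline F_i=\limsup_{T\to\infty}\frac1T\,\mathbb E\Big[\int_0^T F_i(t)\,dt\Big].$$ Put $\beta_r=\frac{\lambda_c}{k}+(r-1)\frac{\lambda_g}{k-1}$ for $1\le r\le k$ (for $k=1$, $\beta_1=\lambda_c$). Then, for every end-node $i$, with (source–CH scheme, intra-cluster scheme) equal to * $(DC_{\mathrm{noRC}},FC_{\mathrm{noRC}})$: $$\overline F_i=\frac{\lambda_s}{\lambda_s+m\lambda_e}\cdot\sum_{r=1}^{k}\left(\prod_{l=1}^{r-1}\frac{(k-l)\beta_l}{(k-l+1)\beta_l+\lambda_e}\right)\frac{\beta_r}{(k-r+1)\beta_r+\lambda_e};$$ * $(DC_{\mathrm{RC}},FC_{\mathrm{noRC}})$: $$\overline F_i=\frac1m\frac{\lambda_s}{\lambda_e}\left[1-\Big(\frac{\lambda_s}{\lambda_s+\lambda_e}\Big)^m\right]\cdot\sum_{r=1}^{k}\left(\prod_{l=1}^{r-1}\frac{(k-l)\beta_l}{(k-l+1)\beta_l+\lambda_e}\right)\frac{\beta_r}{(k-r+1)\beta_r+\lambda_e};$$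 * $(DC_{\mathrm{RC}},FC_{\mathrm{allRC}})$: $$\overline F_i=\frac1m\frac{\lambda_s}{\lambda_e}\left[1-\Big(\frac{\lambda_s}{\lambda_s+\lambda_e}\Big)^m\right]\cdot\frac1k\sum_{r=1}^{k}\prod_{l=1}^{r}\frac{\lambda_c+(l-1)\lambda_g}{\lambda_c+(l-1)\lambda_g+\lambda_e}.$$ -/

import Mathlib

open MeasureTheory ProbabilityTheory

noncomputable section

/-! ### Continuous-time Markov jump processes with competing exponential clocks -/

/-- A jump mechanism on the state space `E`: every event `e : I` rings at rate `rate x e` while the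
state is `x`, and moves the state from `x` to `act x e`. -/
structure JumpMechanism (E I : Type) [Fintype I] where
  rate : E → I → ℝ
  act : E → I → E
  rate_nonneg : ∀ x e, 0 ≤ rate x e
  total_pos : ∀ x, 0 < ∑ e, rate x e

namespace JumpMechanism

variable {E I : Type} [Fintype I]

/-- Total rate of events in state `x`. -/
def totalRate (J : JumpMechanism E I) (x : E) : ℝ := ∑ e, J.rate x e

/-- Law of the event that rings first in state `x`: event `e` has probability
`rate x e / totalRate x`. -/
def eventPMF (J : JumpMechanism E I) (x : E) : PMF I :=
  PMF.ofFintype (fun e => ENNReal.ofReal (J.rate x e / J.totalRate x)) (by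
    have h : 0 < J.totalRate x := J.total_pos x
    rw [← ENNReal.ofReal_sum_of_nonneg
      (fun e _ => div_nonneg (J.rate_nonneg x e) h.le), ← Finset.sum_div]
    change ENNReal.ofReal (J.totalRate x / J.totalRate x) = 1
    rw [div_self h.ne', ENNReal.ofReal_one])

variable [Countable E] [MeasurableSpace E] [MeasurableSingletonClass E]

/-- Given the present state `x`: the law of the waiting time, exponential of rate `totalRate x`. -/
def waitKernel (J : JumpMechanism E I) : Kernel E ℝ :=
  Kernel.ofFunOfCountable fun x => expMeasure (J.totalRate x)

/-- Given the present state `x`: the law of the next state. -/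
def nextKernel (J : JumpMechanism E I) : Kernel E E :=
  Kernel.ofFunOfCountable fun x => ((J.eventPMF x).map (J.act x)).toMeasure

/-- Given the present state: the joint law of the waiting time and the next state
(independent of each other). -/
def stepKernel (J : JumpMechanism E I) : Kernel E (ℝ × E) := J.waitKernel ×ₖ J.nextKernel

instance (J : JumpMechanism E I) : IsMarkovKernel J.waitKernel :=
  ⟨fun x => isProbabilityMeasure_expMeasure (J.total_pos x)⟩

instance (J : JumpMechanism E I) : IsMarkovKernel J.nextKernel :=
  ⟨fun x => inferInstanceAs
    (IsProbabilityMeasure ((J.eventPMF x).map (J.act x)).toMeasure)⟩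

instance (J : JumpMechanism E I) : IsMarkovKernel J.stepKernel := by
  unfold stepKernel; infer_instance

/-- The law of the jump process started at `x₀`, on the space of sequences of pairs. The `n`-th pair
of `ω` consists of the waiting time before the `n`-th event and the state just after it
(`ω 0 = (0, x₀)`). -/
def law (J : JumpMechanism E I) (x₀ : E) : Measure (ℕ → ℝ × E) :=
  Kernel.trajMeasure (X := fun _ => ℝ × E) (Measure.dirac ((0 : ℝ), x₀))
    (fun n => J.stepKernel.comap (fun h : (i : Finset.Iic n) → ℝ × E =>
      (h ⟨n, Finset.mem_Iic.2 le_rfl⟩).2) (by fun_prop))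

instance (J : JumpMechanism E I) (x₀ : E) : IsProbabilityMeasure (J.law x₀) := by
  unfold law; infer_instance

end JumpMechanism

/-- Time of the `n`-th event. -/
def eventTime {E : Type} (ω : ℕ → ℝ × E) (n : ℕ) : ℝ := ∑ i ∈ Finset.range (n + 1), (ω i).1

/-- State at time `t`: the state just after the last event not later than `t`. -/
def stateAt {E : Type} (ω : ℕ → ℝ × E) (t : ℝ) : E := (ω (sSup {n : ℕ | eventTime ω n ≤ t})).2

/-! ### The clustered gossip network -/

/-- Update rates: source self-updates, source to clusterheads (total), a clusterhead to its
nodes (total), and gossip of one node to the others in its cluster (total). -/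
structure GossipRates where
  lamE : ℝ
  lamS : ℝ
  lamC : ℝ
  lamG : ℝ
  lamE_pos : 0 < lamE
  lamS_nonneg : 0 ≤ lamS
  lamC_nonneg : 0 ≤ lamC
  lamG_nonneg : 0 ≤ lamG

/-- Scheme of the (disconnected) source-to-clusterheads network. -/
inductive SourceScheme
  | noRC
  | RC

/-- Scheme of the fully connected network inside each cluster. -/
inductive ClusterScheme
  | noRC
  | allRC

/-- Versions held by the source, by the `m` clusterheads, and by the `k` end-nodes of every
cluster. -/
@[ext]
structure NetState (m k : ℕ) where
  src : ℕ
  ch : Fin m → ℕ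
  node : Fin m → Fin k → ℕ

namespace NetState

variable {m k : ℕ}

instance : Countable (NetState m k) :=
  Function.Injective.countable
    (f := fun x : NetState m k => (x.src, x.ch, x.node)) (by
      rintro ⟨a, b, c⟩ ⟨a', b', c'⟩ h
      simpa using h)

instance : MeasurableSpace (NetState m k) := ⊤

instance : MeasurableSingletonClass (NetState m k) := ⟨fun _ => trivial⟩

/-- No node holds a newer version than its clusterhead, and no clusterhead a newer version than the
source. -/
def Consistent (x : NetState m k) : Prop :=
  (∀ j, x.ch j ≤ x.src) ∧ ∀ j i, x.node j i ≤ x.ch j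

/-- The clusterheads that are stale. -/
def staleCH (x : NetState m k) : Finset (Fin m) := Finset.univ.filter fun j => x.ch j ≠ x.src

/-- The stale end-nodes of cluster `j`. -/
def staleNodes (x : NetState m k) (j : Fin m) : Finset (Fin k) :=
  Finset.univ.filter fun i => x.node j i ≠ x.src

/-- Binary freshness of node `i` of cluster `j`. -/
def fresh (x : NetState m k) (j : Fin m) (i : Fin k) : ℝ := if x.node j i = x.src then 1 else 0

end NetState

/-- The events: the source generates a new version; the source sends its version to clusterhead `j`;
clusterhead `j` sends its version to its node `i`; in cluster `j`, node `a` sends its version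
to node `b`. -/
inductive NetEvent (m k : ℕ)
  | selfUpdate
  | toCH (j : Fin m)
  | toNode (j : Fin m) (i : Fin k)
  | gossip (j : Fin m) (a b : Fin k)
  deriving Fintype

variable {m k : ℕ}

/-- Replace the version of node `i` of cluster `j` by `v`. -/
def setNode (x : NetState m k) (j : Fin m) (i : Fin k) (v : ℕ) : NetState m k :=
  { x with node := Function.update x.node j (Function.update (x.node j) i v) }

/-- Effect of an event. A receiver keeps the newer of its own version and the received one. -/
def netAct (x : NetState m k) : NetEvent m k → NetState m k
  | .selfUpdate => { x with src := x.src + 1 }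
  | .toCH j => { x with ch := Function.update x.ch j (max (x.ch j) x.src) }
  | .toNode j i => setNode x j i (max (x.node j i) (x.ch j))
  | .gossip j a b => setNode x j b (max (x.node j b) (x.node j a))

/-- Rate from the source to clusterhead `j`. Without rate changing the total rate is split evenly
over all clusterheads, with it over the stale ones only. -/
def rateToCH (ρ : GossipRates) (S : SourceScheme) (x : NetState m k) (j : Fin m) : ℝ :=
  match S with
  | .noRC => ρ.lamS / m
  | .RC => if x.ch j ≠ x.src then ρ.lamS / x.staleCH.card else 0

/-- Rate from clusterhead `j` to its node `i`. -/
def rateToNode (ρ : GossipRates) (C : ClusterScheme) (x : NetState m k) (j : Fin m) (i : Fin k) :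
    ℝ :=
  match C with
  | .noRC => ρ.lamC / k
  | .allRC => if x.node j i ≠ x.src then ρ.lamC / (x.staleNodes j).card else 0

/-- Gossip rate from node `a` to node `b` of cluster `j`. Without rate changing every node splits its
total rate evenly over the other nodes of its cluster; with it, every fresh node splits its
total rate evenly over the stale nodes of its cluster. -/
def rateGossip (ρ : GossipRates) (C : ClusterScheme) (x : NetState m k) (j : Fin m)
    (a b : Fin k) : ℝ :=
  match C with
  | .noRC => if a ≠ b then ρ.lamG / ((k : ℝ) - 1) else 0
  | .allRC =>
      if x.node j a = x.src ∧ x.node j b ≠ x.src then ρ.lamG / (x.staleNodes j).card else 0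

/-- Rate of every event in state `x`. -/
def netRate (ρ : GossipRates) (S : SourceScheme) (C : ClusterScheme) (x : NetState m k) :
    NetEvent m k → ℝ
  | .selfUpdate => ρ.lamE
  | .toCH j => rateToCH ρ S x j
  | .toNode j i => rateToNode ρ C x j i
  | .gossip j a b => rateGossip ρ C x j a b

theorem netRate_nonneg (ρ : GossipRates) (S : SourceScheme) (C : ClusterScheme)
    (x : NetState m k) (e : NetEvent m k) : 0 ≤ netRate ρ S C x e := by
  have hE := ρ.lamE_pos.le
  have hS := ρ.lamS_nonneg
  have hC := ρ.lamC_nonneg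
  have hG := ρ.lamG_nonneg
  cases e with
  | selfUpdate => exact hE
  | toCH j =>
    cases S <;> simp only [netRate, rateToCH] <;> (try split_ifs) <;> positivity
  | toNode j i =>
    cases C <;> simp only [netRate, rateToNode] <;> (try split_ifs) <;> positivity
  | gossip j a b =>
    have hk : (0 : ℝ) ≤ (k : ℝ) - 1 := by
      have : 1 ≤ k := a.pos
      have : (1 : ℝ) ≤ k := by exact_mod_cast this
      linarith
    cases C <;> simp only [netRate, rateGossip] <;> split_ifs <;> positivity

/-- The jump mechanism of the clustered network. -/
def network (m k : ℕ) (ρ : GossipRates) (S : SourceScheme) (C : ClusterScheme) :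
    JumpMechanism (NetState m k) (NetEvent m k) where
  rate := netRate ρ S C
  act := netAct
  rate_nonneg := netRate_nonneg ρ S C
  total_pos x := Finset.sum_pos' (fun e _ => netRate_nonneg ρ S C x e)
    ⟨.selfUpdate, Finset.mem_univ _, ρ.lamE_pos⟩

/-- Long-term average freshness `limsup_{T → ∞} (1 / T) E[∫_0^T F(t) dt]` of node `i` of cluster `j`
when the network starts in state `x₀`. -/
def avgFreshness (ρ : GossipRates) (S : SourceScheme) (C : ClusterScheme) (x₀ : NetState m k)
    (j : Fin m) (i : Fin k) : ℝ :=
  Filter.limsup (fun T : ℝ =>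
    (1 / T) * ∫ ω, (∫ t in (0 : ℝ)..T, (stateAt ω t).fresh j i) ∂((network m k ρ S C).law x₀))
    Filter.atTop

end

/-!
Every new version of the source makes all clusterheads and nodes stale, so the freshness pattern
restarts from "everything stale" at each source update. Between two source updates, a node becomes
fresh after its clusterhead has become fresh and the new version has then spread to it inside its
cluster. By the strong Markov property and lack of memory, the long-term fraction of time during
which the node is fresh is the probability that this happens before an exponential clock of rate
`lamE` rings, and this probability is a product of two factors, one for the clusterhead and one for
the node below a fresh clusterhead. Each factor concerns exchangeable receivers, each of which
becomes fresh at rate `b u` while `u` of them are stale, and solves a recursion in `u`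
(`reachProb`); unrolling the recursions gives the closed forms.

The rigorous argument uses neither the strong Markov property nor stationarity. Let `G x` be the
probability, seen from state `x`, that the node is fresh when the source generates its next version
(`freshValue`). It is a bounded function on states and it solves the Poisson equation
`L G = lamE * (c - F)`, where `L` is the generator, `F` the freshness of the node, and `c` the value
of `G` when everything is stale (`poisson_network`). Dynkin's formula bounds
`lamE * (c * T - E ∫₀ᵀ F)` by twice the bound of `G`, uniformly in `T`, so the time averages
converge to `c` (`JumpMechanism.tendsto_average_of_poisson`).

Dynkin's formula is proved event by event. For an exponential waiting time `W` of rate `q`, the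
identity `P(W ≤ r) = q * E[min W r]` (`integral_min_expMeasure`) shows that the expected increment
of a quantity over one event, counted only if the event happens before `T`, is the expected length
of the sojourn cut off at `T` times the drift (`JumpMechanism.integral_increment`). Applied to the
number of events, the same identity shows that the process does not explode
(`JumpMechanism.ae_tendsto_eventTime`), so that the sojourns exhaust `[0, T]`.
-/

/-! ### Exponential waiting times -/

theorem ae_nonneg_expMeasure {q : ℝ} (hq : 0 < q) : ∀ᵐ w ∂expMeasure q, 0 ≤ w := by
  have := isProbabilityMeasure_expMeasure hq
  have h0 : (expMeasure q).real (Set.Iic 0) = 0 := by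
    rw [← cdf_eq_real, cdf_expMeasure_eq hq]; simp
  rw [measureReal_eq_zero_iff] at h0
  rw [ae_iff]
  exact measure_mono_null (fun w hw => by simp at hw ⊢; exact hw.le) h0

/-- The source of Dynkin's formula: for an exponential waiting time of rate `q`, the probability to
be at most `r` is `q` times the expectation of the waiting time cut off at `r`. -/
theorem integral_min_expMeasure {q : ℝ} (hq : 0 < q) {r : ℝ} (hr : 0 ≤ r) :
    (∫ w, min w r ∂expMeasure q) * q = (expMeasure q).real (Set.Iic r) := by
  have := isProbabilityMeasure_expMeasure hq
  have hcdf : ∀ t, (expMeasure q).real (Set.Iic t) = if 0 ≤ t then 1 - Real.exp (-(q * t)) else 0 :=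
    fun t => by rw [← cdf_eq_real, cdf_expMeasure_eq hq]
  have hneg := ae_nonneg_expMeasure hq
  have hint : Integrable (fun w => min w r) (expMeasure q) := by
    refine Integrable.of_bound (by fun_prop) r ?_
    filter_upwards [hneg] with w hw
    rw [Real.norm_of_nonneg (le_min hw hr)]
    exact min_le_right _ _
  -- layer cake: integrate the tail `exp (-q t)` over `[0, r)`
  rw [hint.integral_eq_integral_meas_lt (by filter_upwards [hneg] with w hw using le_min hw hr)]
  have htail : ∀ t ∈ Set.Ioi (0 : ℝ), (expMeasure q).real {w | t < min w r} =
      (Set.Iio r).indicator (fun t => Real.exp (-(q * t))) t := by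
    intro t ht
    by_cases htr : t < r
    · have hset : {w | t < min w r} = (Set.Iic t)ᶜ := by
        ext w; simp [htr]
      rw [hset, probReal_compl_eq_one_sub measurableSet_Iic, hcdf, if_pos (le_of_lt ht),
        Set.indicator_of_mem (by exact htr)]
      ring
    · have hset : {w | t < min w r} = ∅ := by
        ext w; simp [htr]
      rw [hset, Set.indicator_of_notMem (by exact htr)]
      simp
  rw [setIntegral_congr_fun measurableSet_Ioi htail, setIntegral_indicator measurableSet_Iio,
    Set.Ioi_inter_Iio, ← integral_Ioc_eq_integral_Ioo, ← intervalIntegral.integral_of_le hr,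
    hcdf, if_pos hr, ← intervalIntegral.integral_mul_const]
  have := intervalIntegral.integral_eq_sub_of_hasDerivAt (a := 0) (b := r)
    (f := fun a => -Real.exp (-(q * a))) (f' := fun t => q * Real.exp (-(q * t)))
    (fun x _ => hasDerivAt_neg_exp_mul_exp) (by apply Continuous.intervalIntegrable; fun_prop)
  simp only [mul_comm (Real.exp _) q]
  rw [this]
  simp
  ring

/-! ### One step of a jump process -/

@[fun_prop]
theorem measurable_eventTime {E : Type} [MeasurableSpace E] (n : ℕ) :
    Measurable fun ω : ℕ → ℝ × E => eventTime ω n := by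
  unfold eventTime; fun_prop

theorem ae_trajMeasure_dirac_zero {X : ℕ → Type} [∀ n, MeasurableSpace (X n)]
    (κ : (n : ℕ) → Kernel ((i : Finset.Iic n) → X i) (X (n + 1))) [∀ n, IsMarkovKernel (κ n)]
    (a : X 0) (ha : MeasurableSet {z | z = a}) :
    ∀ᵐ ω ∂Kernel.trajMeasure (Measure.dirac a) κ, ω 0 = a := by
  let e := (MeasurableEquiv.piUnique fun i : Finset.Iic 0 => X i).symm
  let u : (i : Finset.Iic 0) → X i := e a
  have htraj : Kernel.trajMeasure (Measure.dirac a) κ = Kernel.traj κ 0 u :=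
    (congrArg (fun μ => Measure.bind μ (Kernel.traj κ 0)) (Measure.map_dirac' e.measurable a)).trans
      (Measure.dirac_bind (Kernel.measurable _) u)
  rw [htraj]
  have hmap := Kernel.traj_map_frestrictLe_apply (κ := κ) 0 0 u
  rw [Kernel.partialTraj_self, Kernel.id_apply] at hmap
  have hd : ∀ᵐ h ∂(Measure.dirac u), h ⟨0, Finset.mem_Iic.2 le_rfl⟩ = a := by
    rw [ae_dirac_iff]
    · rfl
    · exact ha.preimage (measurable_pi_apply _)
  rw [← hmap] at hd
  exact ae_of_ae_map (by fun_prop) hd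

namespace JumpMechanism

variable {E I : Type} [Fintype I] [Countable E] [MeasurableSpace E] [MeasurableSingletonClass E]
  (J : JumpMechanism E I)

theorem waitKernel_apply (x : E) : J.waitKernel x = expMeasure (J.totalRate x) := rfl

theorem nextKernel_apply (x : E) :
    J.nextKernel x = ((J.eventPMF x).map (J.act x)).toMeasure := rfl

theorem stepKernel_apply (x : E) : J.stepKernel x = (J.waitKernel x).prod (J.nextKernel x) :=
  Kernel.prod_apply _ _ _

theorem nextKernel_eq_map [MeasurableSpace I] [MeasurableSingletonClass I] (x : E) :
    J.nextKernel x = (J.eventPMF x).toMeasure.map (J.act x) := by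
  rw [nextKernel_apply, PMF.toMeasure_map _ _ (measurable_of_countable _)]

theorem integral_nextKernel (x : E) (Φ : E → ℝ) :
    J.totalRate x * ∫ y, Φ y ∂J.nextKernel x = ∑ e, J.rate x e * Φ (J.act x e) := by
  let _ : MeasurableSpace I := ⊤
  have hq : 0 < J.totalRate x := J.total_pos x
  rw [nextKernel_eq_map, integral_map (measurable_of_countable _).aemeasurable
    (Measurable.of_discrete.aestronglyMeasurable), PMF.integral_eq_sum, Finset.mul_sum]
  refine Finset.sum_congr rfl fun e _ => ?_
  have : ((J.eventPMF x) e).toReal = J.rate x e / J.totalRate x := by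
    rw [eventPMF, PMF.ofFintype_apply,
      ENNReal.toReal_ofReal (div_nonneg (J.rate_nonneg x e) hq.le)]
  rw [this, smul_eq_mul]
  field_simp

theorem ae_nextKernel (x : E) {p : E → Prop} (h : ∀ e, p (J.act x e)) :
    ∀ᵐ y ∂J.nextKernel x, p y := by
  let _ : MeasurableSpace I := ⊤
  rw [nextKernel_eq_map, ae_map_iff (measurable_of_countable _).aemeasurable
    (Set.to_countable _).measurableSet]
  exact Filter.Eventually.of_forall h

theorem ae_stepKernel (x : E) {p : E → Prop} (h : ∀ e, p (J.act x e)) :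
    ∀ᵐ y ∂J.stepKernel x, 0 ≤ y.1 ∧ p y.2 := by
  rw [stepKernel_apply]
  have h1 : ∀ᵐ y ∂(J.waitKernel x).prod (J.nextKernel x), 0 ≤ y.1 :=
    Measure.quasiMeasurePreserving_fst.ae (ae_nonneg_expMeasure (J.total_pos x))
  have h2 : ∀ᵐ y ∂(J.waitKernel x).prod (J.nextKernel x), p y.2 :=
    Measure.quasiMeasurePreserving_snd.ae (J.ae_nextKernel x h)
  exact h1.and h2

/-- Dynkin's formula for one step: from time `s` and state `x`, the expectation of `Φ` at the next
state, counted only if the step is over by time `T`, is the expected sojourn cut off at `T` times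
the expected rate of change. For `s > T` both sides vanish. -/
theorem integral_stepKernel (s T : ℝ) (x : E) (Φ : E → ℝ) :
    ∫ y, (if s + y.1 ≤ T then Φ y.2 else 0) ∂J.stepKernel x =
      ∫ y, (min (s + y.1) T - min s T) * ∑ e, J.rate x e * Φ (J.act x e) ∂J.stepKernel x := by
  have hq : 0 < J.totalRate x := J.total_pos x
  rcases le_or_gt s T with hs | hs
  · have := isProbabilityMeasure_expMeasure hq
    have hmul : ∀ y : ℝ × E, (if s + y.1 ≤ T then Φ y.2 else 0) =
        (Set.Iic (T - s)).indicator (fun _ => (1 : ℝ)) y.1 * Φ y.2 := by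
      intro y
      by_cases hy : s + y.1 ≤ T
      · rw [if_pos hy, Set.indicator_of_mem (by simp; linarith), one_mul]
      · rw [if_neg hy, Set.indicator_of_notMem (by simp; linarith), zero_mul]
    have hmin : ∀ w : ℝ, min (s + w) T - min s T = min w (T - s) := by
      intro w
      rw [min_eq_left hs, ← min_sub_sub_right]; ring_nf
    simp_rw [hmul, hmin]
    rw [stepKernel_apply, integral_prod_mul
        (fun w => (Set.Iic (T - s)).indicator (fun _ => (1 : ℝ)) w) Φ,
      integral_mul_const, integral_fun_fst (f := fun w => min w (T - s)),
      ← integral_nextKernel, waitKernel_apply, integral_indicator measurableSet_Iic]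
    simp only [integral_const, probReal_univ, smul_eq_mul, mul_one]
    rw [measureReal_restrict_apply_univ, ← integral_min_expMeasure hq (by linarith)]
    ring
  · have hT : ∀ᵐ y ∂J.stepKernel x, T < s + y.1 := by
      filter_upwards [J.ae_stepKernel x (p := fun _ => True) (by simp)] with y hy
      linarith [hy.1]
    refine integral_congr_ae ?_
    filter_upwards [hT] with y hy
    rw [if_neg (not_le.2 hy), min_eq_right hy.le, min_eq_right hs.le, sub_self, zero_mul]

/-! ### The law of a jump process -/

theorem law_zero (x₀ : E) : ∀ᵐ ω ∂J.law x₀, ω 0 = ((0 : ℝ), x₀) := by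
  refine ae_trajMeasure_dirac_zero (X := fun _ => ℝ × E) _ _ ?_
  exact measurableSet_eq_fun measurable_id measurable_const

/-- Given the first `n` events, the next one is distributed according to the step kernel at the
present state. -/
theorem law_map_succ (x₀ : E) (n : ℕ) :
    ((J.law x₀).map (Preorder.frestrictLe (π := fun _ => ℝ × E) n)) ⊗ₘ
      (J.stepKernel.comap (fun h : (i : Finset.Iic n) → ℝ × E =>
      (h ⟨n, Finset.mem_Iic.2 le_rfl⟩).2) (by fun_prop)) =
    (J.law x₀).map (fun ω => (Preorder.frestrictLe (π := fun _ => ℝ × E) n ω, ω (n + 1))) :=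
  Kernel.map_frestrictLe_trajMeasure_compProd_eq_map_trajMeasure (X := fun _ => ℝ × E)

theorem law_ae_succ (x₀ : E) (n : ℕ) {p : E → ℝ × E → Prop}
    (hp : MeasurableSet {z : E × (ℝ × E) | p z.1 z.2})
    (h' : ∀ x, ∀ᵐ y ∂J.stepKernel x, p x y) :
    ∀ᵐ ω ∂J.law x₀, p (ω n).2 (ω (n + 1)) := by
  have hm : MeasurableSet {z : ((i : Finset.Iic n) → ℝ × E) × (ℝ × E) |
      p (z.1 ⟨n, Finset.mem_Iic.2 le_rfl⟩).2 z.2} :=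
    hp.preimage (f := fun z : ((i : Finset.Iic n) → ℝ × E) × (ℝ × E) =>
      ((z.1 ⟨n, Finset.mem_Iic.2 le_rfl⟩).2, z.2)) (by fun_prop)
  have key : ∀ᵐ z ∂(((J.law x₀).map (Preorder.frestrictLe (π := fun _ => ℝ × E) n)) ⊗ₘ
      (J.stepKernel.comap (fun h : (i : Finset.Iic n) → ℝ × E =>
      (h ⟨n, Finset.mem_Iic.2 le_rfl⟩).2) (by fun_prop))),
      p (z.1 ⟨n, Finset.mem_Iic.2 le_rfl⟩).2 z.2 := by
    rw [Measure.ae_compProd_iff hm]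
    exact Filter.Eventually.of_forall fun h => h' _
  rw [law_map_succ] at key
  exact ae_of_ae_map (by fun_prop) key

/-- The Markov property for functions of the present time, the present state and the next step. -/
theorem integral_law_succ (x₀ : E) (n : ℕ) {g : ℝ → E → ℝ × E → ℝ}
    (hg : Measurable fun z : ℝ × E × (ℝ × E) => g z.1 z.2.1 z.2.2)
    (hi : Integrable (fun ω => g (eventTime ω n) (ω n).2 (ω (n + 1))) (J.law x₀)) :
    ∫ ω, g (eventTime ω n) (ω n).2 (ω (n + 1)) ∂J.law x₀ =
      ∫ ω, ∫ y, g (eventTime ω n) (ω n).2 y ∂J.stepKernel (ω n).2 ∂J.law x₀ := by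
  have hS : ∀ ω : ℕ → ℝ × E, eventTime ω n =
      ∑ i : Finset.Iic n, (Preorder.frestrictLe (π := fun _ => ℝ × E) n ω i).1 := by
    intro ω
    have hr : Finset.range (n + 1) = Finset.Iic n := by ext; simp
    simp only [Preorder.frestrictLe_apply]
    rw [Finset.sum_coe_sort (Finset.Iic n) fun i => (ω i).1, eventTime, hr]
  set G : ((i : Finset.Iic n) → ℝ × E) × (ℝ × E) → ℝ := fun z =>
    g (∑ i : Finset.Iic n, (z.1 i).1) (z.1 ⟨n, Finset.mem_Iic.2 le_rfl⟩).2 z.2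
  have hG : Measurable G :=
    hg.comp (f := fun z : ((i : Finset.Iic n) → ℝ × E) × (ℝ × E) =>
      (∑ i : Finset.Iic n, (z.1 i).1, (z.1 ⟨n, Finset.mem_Iic.2 le_rfl⟩).2, z.2)) (by fun_prop)
  have hGω : ∀ ω : ℕ → ℝ × E, ∀ y, g (eventTime ω n) (ω n).2 y =
      G (Preorder.frestrictLe (π := fun _ => ℝ × E) n ω, y) := by
    intro ω y; rw [hS ω]; rfl
  simp_rw [hGω] at hi ⊢
  rw [← integral_map (φ := fun ω : ℕ → ℝ × E =>
      (Preorder.frestrictLe (π := fun _ => ℝ × E) n ω, ω (n + 1))) (by fun_prop)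
      hG.aestronglyMeasurable, ← law_map_succ, Measure.integral_compProd,
    integral_map (by fun_prop)]
  · rfl
  · exact hG.stronglyMeasurable.integral_kernel_prod_right'.aestronglyMeasurable
  · rw [law_map_succ, integrable_map_measure hG.aestronglyMeasurable (by fun_prop)]
    exact hi

end JumpMechanism

/-! ### Paths of a jump process -/

theorem eventTime_succ {E : Type} (ω : ℕ → ℝ × E) (n : ℕ) :
    eventTime ω (n + 1) = eventTime ω n + (ω (n + 1)).1 := by
  unfold eventTime; rw [Finset.sum_range_succ _ (n + 1)]

theorem eventTime_mono {E : Type} {ω : ℕ → ℝ × E} (hω : ∀ n, 0 ≤ (ω n).1) :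
    Monotone (eventTime ω) :=
  monotone_nat_of_le_succ fun n => by rw [eventTime_succ]; linarith [hω (n + 1)]

theorem stateAt_eq {E : Type} {ω : ℕ → ℝ × E} (hω : ∀ n, 0 ≤ (ω n).1) {n : ℕ} {t : ℝ}
    (h1 : eventTime ω n ≤ t) (h2 : t < eventTime ω (n + 1)) : stateAt ω t = (ω n).2 := by
  have hset : {k : ℕ | eventTime ω k ≤ t} = Set.Iic n := by
    ext k
    refine ⟨fun hk => ?_, fun hk => (eventTime_mono hω hk).trans h1⟩
    by_contra hlt
    exact absurd (hk.trans_lt h2) (not_lt.2 (eventTime_mono hω (by simpa using hlt)))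
  rw [stateAt, hset, csSup_Iic]

/-- Up to a time `T` that precedes the `N`-th event, the time integral along a path is the sum over
the sojourns, each cut off at `T`. -/
theorem integral_stateAt {E : Type} {ω : ℕ → ℝ × E} (hω : ∀ n, 0 ≤ (ω n).1)
    (h0 : eventTime ω 0 = 0) {T : ℝ} (hT : 0 ≤ T) {N : ℕ} (hN : T < eventTime ω N) (F : E → ℝ) :
    ∫ t in (0 : ℝ)..T, F (stateAt ω t) = ∑ n ∈ Finset.range N,
      (min (eventTime ω (n + 1)) T - min (eventTime ω n) T) * F (ω n).2 := by
  set a : ℕ → ℝ := fun n => min (eventTime ω n) T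
  have hle : ∀ n, a n ≤ a (n + 1) := fun n =>
    min_le_min_right _ (eventTime_mono hω (Nat.le_succ n))
  have hconst : ∀ n, ∀ t ∈ Set.Ioo (a n) (a (n + 1)), F (ω n).2 = F (stateAt ω t) := by
    intro n t ht
    have h2 := lt_min_iff.1 ht.2
    rw [stateAt_eq hω (n := n) _ h2.1]
    rcases min_lt_iff.1 ht.1 with h | h
    · exact h.le
    · exact absurd h (not_lt.2 h2.2.le)
  have hint : ∀ n, IntervalIntegrable (fun t => F (stateAt ω t)) volume (a n) (a (n + 1)) := by
    intro n
    rw [intervalIntegrable_iff_integrableOn_Ioo_of_le (hle n)]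
    exact (integrableOn_const (C := F (ω n).2) (by simp)).congr_fun (hconst n) measurableSet_Ioo
  have ha0 : a 0 = 0 := by simp [a, h0, hT]
  have haN : a N = T := min_eq_right hN.le
  have hsum := intervalIntegral.sum_integral_adjacent_intervals (n := N) fun n _ => hint n
  rw [ha0, haN] at hsum
  rw [← hsum]
  refine Finset.sum_congr rfl fun n _ => ?_
  rw [intervalIntegral.integral_of_le (hle n), integral_Ioc_eq_integral_Ioo,
    ← setIntegral_congr_fun measurableSet_Ioo (hconst n), setIntegral_const]
  simp [hle n, a]

theorem sum_range_min_sub {E : Type} {ω : ℕ → ℝ × E} (h0 : eventTime ω 0 = 0) {T : ℝ} (hT : 0 ≤ T)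
    (N : ℕ) : ∑ n ∈ Finset.range N, (min (eventTime ω (n + 1)) T - min (eventTime ω n) T) =
      min (eventTime ω N) T := by
  rw [Finset.sum_range_sub (fun n => min (eventTime ω n) T), h0, min_eq_left hT, sub_zero]

/-- The increments of `G` over the events up to time `T` telescope. -/
theorem abs_sum_increments_le {E : Type} {ω : ℕ → ℝ × E} (hω : ∀ n, 0 ≤ (ω n).1) (T : ℝ)
    {G : E → ℝ} {B : ℝ} (hG : ∀ x, |G x| ≤ B) (N : ℕ) :
    |∑ n ∈ Finset.range N,
      if eventTime ω (n + 1) ≤ T then G (ω (n + 1)).2 - G (ω n).2 else 0| ≤ 2 * B := by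
  have key : ∃ M, (∑ n ∈ Finset.range N,
      if eventTime ω (n + 1) ≤ T then G (ω (n + 1)).2 - G (ω n).2 else 0) =
      G (ω M).2 - G (ω 0).2 ∧ (eventTime ω N ≤ T → M = N) := by
    induction N with
    | zero => exact ⟨0, by simp, fun _ => rfl⟩
    | succ N ih =>
      obtain ⟨M, hM, hMN⟩ := ih
      rw [Finset.sum_range_succ, hM]
      by_cases h : eventTime ω (N + 1) ≤ T
      · have := hMN ((eventTime_mono hω N.le_succ).trans h)
        subst this
        exact ⟨M + 1, by rw [if_pos h]; ring, fun _ => rfl⟩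
      · exact ⟨M, by rw [if_neg h, add_zero], fun h' => absurd h' h⟩
  obtain ⟨M, hM, -⟩ := key
  rw [hM]
  linarith [abs_sub (G (ω M).2) (G (ω 0).2), hG (ω M).2, hG (ω 0).2]

namespace JumpMechanism

section Drift

variable {E I : Type} [Fintype I]

/-- Expected rate of change in state `x` of a quantity that every event changes by
`Φ (old state) (new state)`. -/
noncomputable def drift (J : JumpMechanism E I) (Φ : E → E → ℝ) (x : E) : ℝ :=
  ∑ e, J.rate x e * Φ x (J.act x e)

theorem abs_drift_le {J : JumpMechanism E I} {Q : ℝ} (hQ : ∀ x, J.totalRate x ≤ Q)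
    {Φ : E → E → ℝ} {B : ℝ} (hΦ : ∀ x y, |Φ x y| ≤ B) (x : E) :
    |J.drift Φ x| ≤ Q * B := by
  have hB : 0 ≤ B := (abs_nonneg _).trans (hΦ x x)
  calc |J.drift Φ x| ≤ ∑ e, |J.rate x e * Φ x (J.act x e)| := Finset.abs_sum_le_sum_abs _ _
    _ ≤ ∑ e, J.rate x e * B := Finset.sum_le_sum fun e _ => by
        rw [abs_mul, abs_of_nonneg (J.rate_nonneg x e)]
        exact mul_le_mul_of_nonneg_left (hΦ _ _) (J.rate_nonneg x e)
    _ = J.totalRate x * B := by rw [← Finset.sum_mul]; rfl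
    _ ≤ Q * B := mul_le_mul_of_nonneg_right (hQ x) hB

end Drift

variable {E I : Type} [Fintype I] [Countable E] [MeasurableSpace E] [MeasurableSingletonClass E]
  (J : JumpMechanism E I)

/-- Almost surely, all waiting times are nonnegative and the process stays in a closed set of states
that contains its starting point. -/
theorem ae_law_good {C : Set E} (hC : ∀ x ∈ C, ∀ e, J.act x e ∈ C) {x₀ : E} (hx₀ : x₀ ∈ C) :
    ∀ᵐ ω ∂J.law x₀, eventTime ω 0 = 0 ∧ ∀ n, 0 ≤ (ω n).1 ∧ (ω n).2 ∈ C := by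
  have hstep : ∀ n, ∀ᵐ ω ∂J.law x₀,
      0 ≤ (ω (n + 1)).1 ∧ ((ω n).2 ∈ C → (ω (n + 1)).2 ∈ C) := by
    intro n
    refine J.law_ae_succ x₀ n (p := fun x y => 0 ≤ y.1 ∧ (x ∈ C → y.2 ∈ C)) ?_ fun x =>
      J.ae_stepKernel x (p := fun y => x ∈ C → y ∈ C) fun e hx => hC x hx e
    have hCm : MeasurableSet C := (Set.to_countable C).measurableSet
    refine MeasurableSet.inter (measurableSet_le (f := fun _ : E × ℝ × E => (0 : ℝ))
      (g := fun z : E × ℝ × E => z.2.1) (by fun_prop) (by fun_prop)) ?_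
    have : {a : E × ℝ × E | a.1 ∈ C → a.2.2 ∈ C} =
        {a : E × ℝ × E | a.1 ∈ Cᶜ} ∪ {a : E × ℝ × E | a.2.2 ∈ C} := by
      ext a; simp [imp_iff_not_or]
    change MeasurableSet {a : E × ℝ × E | a.1 ∈ C → a.2.2 ∈ C}
    rw [this]
    exact (hCm.compl.preimage measurable_fst).union
      (hCm.preimage (measurable_snd.comp measurable_snd))
  filter_upwards [J.law_zero x₀, ae_all_iff.2 hstep] with ω h0 hs
  refine ⟨by simp [eventTime, h0], fun n => ?_⟩
  induction n with
  | zero => rw [h0]; exact ⟨le_rfl, hx₀⟩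
  | succ n ih => exact ⟨(hs n).1, (hs n).2 ih.2⟩

theorem ae_law_nonneg (x₀ : E) :
    ∀ᵐ ω ∂J.law x₀, eventTime ω 0 = 0 ∧ ∀ n, 0 ≤ (ω n).1 := by
  filter_upwards [J.ae_law_good (C := Set.univ) (fun _ _ _ => trivial) (Set.mem_univ x₀)] with ω h
  exact ⟨h.1, fun n => (h.2 n).1⟩

variable {J} {Q : ℝ}

theorem integrable_sojourn (x₀ : E) (n : ℕ) {T : ℝ} (hT : 0 ≤ T) {f : E → ℝ} {K : ℝ}
    (hf : ∀ x, |f x| ≤ K) :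
    Integrable (fun ω => (min (eventTime ω (n + 1)) T - min (eventTime ω n) T) * f (ω n).2)
      (J.law x₀) := by
  have hfm : Measurable f := Measurable.of_discrete
  refine Integrable.of_bound (Measurable.aestronglyMeasurable (by fun_prop)) (T * K) ?_
  filter_upwards [J.ae_law_nonneg x₀] with ω hω
  have h0 : 0 ≤ eventTime ω n := hω.1 ▸ eventTime_mono hω.2 (Nat.zero_le n)
  have h1 : 0 ≤ eventTime ω (n + 1) := hω.1 ▸ eventTime_mono hω.2 (Nat.zero_le (n + 1))
  rw [norm_mul]
  refine mul_le_mul ?_ (hf _) (norm_nonneg _) hT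
  rw [Real.norm_eq_abs, abs_le]
  constructor <;>
    linarith [le_min h0 hT, le_min h1 hT, min_le_right (eventTime ω n) T,
      min_le_right (eventTime ω (n + 1)) T]

theorem integrable_increment (x₀ : E) (n : ℕ) (T : ℝ) {Φ : E → E → ℝ} {B : ℝ}
    (hΦ : ∀ x y, |Φ x y| ≤ B) :
    Integrable (fun ω => if eventTime ω (n + 1) ≤ T then Φ (ω n).2 (ω (n + 1)).2 else 0)
      (J.law x₀) := by
  have hΦm : Measurable (Function.uncurry Φ) := Measurable.of_discrete
  refine Integrable.of_bound (Measurable.aestronglyMeasurable ?_) B ?_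
  · exact Measurable.ite (measurableSet_le (by fun_prop) (by fun_prop))
      (hΦm.comp (f := fun ω : ℕ → ℝ × E => ((ω n).2, (ω (n + 1)).2)) (by fun_prop))
      measurable_const
  · refine Filter.Eventually.of_forall fun ω => ?_
    split_ifs
    · exact hΦ _ _
    · simpa using (abs_nonneg _).trans (hΦ (ω n).2 (ω n).2)

/-- Dynkin's formula for a single jump, cut off at time `T`. -/
theorem integral_increment (hQ : ∀ x, J.totalRate x ≤ Q) (x₀ : E) (n : ℕ) {T : ℝ}
    (hT : 0 ≤ T) {Φ : E → E → ℝ} {B : ℝ} (hΦ : ∀ x y, |Φ x y| ≤ B) :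
    ∫ ω, (if eventTime ω (n + 1) ≤ T then Φ (ω n).2 (ω (n + 1)).2 else 0) ∂J.law x₀ =
      ∫ ω, (min (eventTime ω (n + 1)) T - min (eventTime ω n) T) * J.drift Φ (ω n).2
        ∂J.law x₀ := by
  have hi1 := integrable_increment (J := J) x₀ n T hΦ
  have hi2 := integrable_sojourn (J := J) x₀ n hT (abs_drift_le hQ hΦ)
  simp_rw [eventTime_succ] at hi1 hi2 ⊢
  have hΦm : Measurable (Function.uncurry Φ) := Measurable.of_discrete
  have hdm : Measurable (J.drift Φ) := Measurable.of_discrete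
  rw [J.integral_law_succ x₀ n (g := fun s x y => if s + y.1 ≤ T then Φ x y.2 else 0) _ hi1,
    J.integral_law_succ x₀ n
      (g := fun s x y => (min (s + y.1) T - min s T) * J.drift Φ x) _ hi2]
  · exact integral_congr_ae (Filter.Eventually.of_forall fun ω =>
      J.integral_stepKernel (eventTime ω n) T (ω n).2 (Φ (ω n).2))
  · fun_prop
  · exact Measurable.ite (measurableSet_le (by fun_prop) (by fun_prop))
      (hΦm.comp (f := fun z : ℝ × E × (ℝ × E) => (z.2.1, z.2.2.2)) (by fun_prop))
      measurable_const

/-- A jump process with bounded rates does not explode: by Dynkin's formula for the number of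
events, at most `Q * T` events are expected before time `T`. -/
theorem ae_tendsto_eventTime (hQ : ∀ x, J.totalRate x ≤ Q) (x₀ : E) :
    ∀ᵐ ω ∂J.law x₀, Filter.Tendsto (eventTime ω) Filter.atTop Filter.atTop := by
  have hQ0 : 0 ≤ Q := (J.total_pos x₀).le.trans (hQ x₀)
  have hbound : ∀ T : ℝ, 0 ≤ T → ∀ N : ℕ,
      ∑ n ∈ Finset.range N, (J.law x₀).real {ω | eventTime ω (n + 1) ≤ T} ≤ Q * T := by
    intro T hT N
    have hΦ : ∀ x y : E, |(fun _ _ : E => (1 : ℝ)) x y| ≤ 1 := by simp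
    have hterm : ∀ n, (J.law x₀).real {ω | eventTime ω (n + 1) ≤ T} =
        ∫ ω, (min (eventTime ω (n + 1)) T - min (eventTime ω n) T) * J.drift (fun _ _ => 1) (ω n).2
          ∂J.law x₀ := by
      intro n
      rw [← integral_increment hQ x₀ n hT hΦ, ← integral_indicator_one
        (measurableSet_le (by fun_prop) (by fun_prop))]
      rfl
    simp_rw [hterm]
    rw [← integral_finsetSum _ fun n _ => integrable_sojourn (J := J) x₀ n hT (abs_drift_le hQ hΦ)]
    have hle : ∀ᵐ ω ∂J.law x₀, ∑ n ∈ Finset.range N,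
        (min (eventTime ω (n + 1)) T - min (eventTime ω n) T) * J.drift (fun _ _ => 1) (ω n).2
        ≤ Q * T := by
      filter_upwards [J.ae_law_nonneg x₀] with ω hω
      calc _ ≤ ∑ n ∈ Finset.range N,
            (min (eventTime ω (n + 1)) T - min (eventTime ω n) T) * Q := by
            refine Finset.sum_le_sum fun n _ => mul_le_mul_of_nonneg_left ?_ ?_
            · simpa using (le_abs_self _).trans (abs_drift_le hQ hΦ (ω n).2)
            · exact sub_nonneg.2 (min_le_min_right _ (eventTime_mono hω.2 n.le_succ))
        _ = min (eventTime ω N) T * Q := by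
            rw [← Finset.sum_mul, sum_range_min_sub hω.1 hT]
        _ ≤ Q * T := by
            rw [mul_comm]; exact mul_le_mul_of_nonneg_left (min_le_right _ _) hQ0
    calc _ ≤ ∫ _, Q * T ∂J.law x₀ := integral_mono_ae
          (integrable_finsetSum _ fun n _ =>
            integrable_sojourn (J := J) x₀ n hT (abs_drift_le hQ hΦ))
          (integrable_const _) hle
      _ = Q * T := by simp
  have hev : ∀ T : ℕ, ∀ᵐ ω ∂J.law x₀, ∀ᶠ n in Filter.atTop, ¬ eventTime ω (n + 1) ≤ T := by
    intro T
    refine ae_eventually_notMem (s := fun n => {ω | eventTime ω (n + 1) ≤ (T : ℝ)}) ?_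
    refine ne_top_of_le_ne_top (b := ENNReal.ofReal (Q * T)) ENNReal.ofReal_ne_top ?_
    refine ENNReal.tsum_le_of_sum_range_le fun N => ?_
    refine le_trans (le_of_eq ?_) (ENNReal.ofReal_le_ofReal (hbound T T.cast_nonneg N))
    rw [ENNReal.ofReal_sum_of_nonneg fun _ _ => measureReal_nonneg]
    exact Finset.sum_congr rfl fun n _ => (ofReal_measureReal).symm
  filter_upwards [J.ae_law_nonneg x₀, ae_all_iff.2 hev] with ω hω hT
  refine Filter.tendsto_atTop_atTop_of_monotone (eventTime_mono hω.2) fun b => ?_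
  obtain ⟨T, hbT⟩ := exists_nat_ge b
  obtain ⟨n, hn⟩ := (hT T).exists
  exact ⟨n + 1, hbT.trans (not_le.1 hn).le⟩

/-- Since the process does not explode, the expected integral of `F` along the path up to `T` is
obtained from the sojourns between consecutive events. -/
theorem tendsto_integral_sojourns (hQ : ∀ x, J.totalRate x ≤ Q) (x₀ : E) {T : ℝ}
    (hT : 0 ≤ T) {F : E → ℝ} {K : ℝ} (hF : ∀ x, |F x| ≤ K) :
    Filter.Tendsto (fun N => ∫ ω, ∑ n ∈ Finset.range N,
        (min (eventTime ω (n + 1)) T - min (eventTime ω n) T) * F (ω n).2 ∂J.law x₀)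
      Filter.atTop (nhds (∫ ω, (∫ t in (0 : ℝ)..T, F (stateAt ω t)) ∂J.law x₀)) := by
  refine tendsto_integral_of_dominated_convergence (fun _ => T * K)
    (fun N => (integrable_finsetSum _ fun n _ =>
      integrable_sojourn (J := J) x₀ n hT hF).aestronglyMeasurable) (integrable_const _) ?_ ?_
  · intro N
    filter_upwards [J.ae_law_nonneg x₀] with ω hω
    have hK : 0 ≤ K := (abs_nonneg _).trans (hF x₀)
    calc _ ≤ ∑ n ∈ Finset.range N,
          (min (eventTime ω (n + 1)) T - min (eventTime ω n) T) * K := by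
          refine norm_sum_le_of_le _ fun n _ => ?_
          have h0 := sub_nonneg.2 (min_le_min_right T (eventTime_mono hω.2 n.le_succ))
          rw [norm_mul, Real.norm_of_nonneg h0]
          exact mul_le_mul_of_nonneg_left (hF _) h0
      _ = min (eventTime ω N) T * K := by rw [← Finset.sum_mul, sum_range_min_sub hω.1 hT]
      _ ≤ T * K := mul_le_mul_of_nonneg_right (min_le_right _ _) hK
  · filter_upwards [J.ae_law_nonneg x₀, ae_tendsto_eventTime hQ x₀] with ω hω hω'
    refine tendsto_const_nhds.congr' ?_
    filter_upwards [hω'.eventually_gt_atTop T] with N hN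
    exact integral_stateAt hω.2 hω.1 hT hN F

/-- **Time averages from a Poisson equation.** If a bounded function `G` satisfies
`L G = κ (c - F)` for the generator `L` on a closed set of states, then `c` is the long-term
average of `F`. -/
theorem tendsto_average_of_poisson (hQ : ∀ x, J.totalRate x ≤ Q) {C : Set E}
    (hC : ∀ x ∈ C, ∀ e, J.act x e ∈ C) {x₀ : E} (hx₀ : x₀ ∈ C) {F G : E → ℝ} {K B κ c : ℝ}
    (hF : ∀ x, |F x| ≤ K) (hG : ∀ x, |G x| ≤ B) (hκ : 0 < κ)
    (hP : ∀ x ∈ C, ∑ e, J.rate x e * (G (J.act x e) - G x) = κ * (c - F x)) :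
    Filter.Tendsto
      (fun T : ℝ => (1 / T) * ∫ ω, (∫ t in (0 : ℝ)..T, F (stateAt ω t)) ∂J.law x₀)
      Filter.atTop (nhds c) := by
  set A : ℝ → ℝ := fun T => ∫ ω, (∫ t in (0 : ℝ)..T, F (stateAt ω t)) ∂J.law x₀ with hA
  have hΦ : ∀ x y : E, |(fun x y => G y - G x) x y| ≤ 2 * B := fun x y => by
    linarith [abs_sub (G y) (G x), hG x, hG y]
  have hdrift : ∀ x ∈ C, J.drift (fun x y => G y - G x) x = κ * (c - F x) := hP
  have hbound : ∀ T : ℝ, 0 ≤ T → |κ * (c * T - A T)| ≤ 2 * B := by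
    intro T hT
    have h1 := tendsto_integral_sojourns hQ x₀ hT (F := fun _ => (1 : ℝ)) (K := 1) (by simp)
    have h2 := tendsto_integral_sojourns hQ x₀ hT hF
    have hlim := (((h1.const_mul c).sub h2).const_mul κ).abs
    have hone : ∫ _, (∫ _ in (0 : ℝ)..T, (1 : ℝ)) ∂J.law x₀ = T := by simp
    rw [hone] at hlim
    refine le_of_tendsto hlim (Filter.Eventually.of_forall fun N => ?_)
    have hi1 := fun n =>
      integrable_sojourn (J := J) x₀ n hT (f := fun _ => (1 : ℝ)) (K := 1) (by simp)
    have hi2 := fun n => integrable_sojourn (J := J) x₀ n hT hF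
    -- by Dynkin's formula for `G`, the expectation is that of the increments of `G`
    rw [← integral_const_mul, ← integral_sub ((integrable_finsetSum _ fun n _ => hi1 n).const_mul c)
      (integrable_finsetSum _ fun n _ => hi2 n), ← integral_const_mul]
    have heq : ∫ ω, κ * (c * (∑ n ∈ Finset.range N,
          (min (eventTime ω (n + 1)) T - min (eventTime ω n) T) * 1) - ∑ n ∈ Finset.range N,
          (min (eventTime ω (n + 1)) T - min (eventTime ω n) T) * F (ω n).2) ∂J.law x₀ =
        ∫ ω, ∑ n ∈ Finset.range N,
          (if eventTime ω (n + 1) ≤ T then G (ω (n + 1)).2 - G (ω n).2 else 0) ∂J.law x₀ := by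
      rw [integral_finsetSum _ fun n _ => integrable_increment (J := J) x₀ n T hΦ,
        Finset.sum_congr rfl fun n _ => integral_increment hQ x₀ n hT hΦ,
        ← integral_finsetSum _ fun n _ => integrable_sojourn (J := J) x₀ n hT (abs_drift_le hQ hΦ)]
      refine integral_congr_ae ?_
      filter_upwards [J.ae_law_good hC hx₀] with ω hω
      rw [Finset.mul_sum, ← Finset.sum_sub_distrib, Finset.mul_sum]
      refine Finset.sum_congr rfl fun n _ => ?_
      rw [hdrift _ (hω.2 n).2]
      ring
    rw [heq, ← Real.norm_eq_abs]
    refine (norm_integral_le_of_norm_le_const (C := 2 * B) ?_).trans (by simp)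
    filter_upwards [J.ae_law_nonneg x₀] with ω hω
    exact abs_sum_increments_le hω.2 T hG N
  have hzero : Filter.Tendsto (fun T : ℝ => 2 * B / κ / T) Filter.atTop (nhds 0) :=
    tendsto_const_nhds.div_atTop Filter.tendsto_id
  rw [tendsto_iff_norm_sub_tendsto_zero]
  refine tendsto_of_tendsto_of_tendsto_of_le_of_le' tendsto_const_nhds hzero
    (Filter.Eventually.of_forall fun _ => norm_nonneg _) ?_
  filter_upwards [Filter.eventually_gt_atTop 0] with T hT
  have hb := hbound T hT.le
  rw [abs_mul, abs_of_pos hκ] at hb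
  have : 1 / T * A T - c = -(c * T - A T) / T := by field_simp; ring
  rw [this, norm_div, norm_neg, Real.norm_eq_abs, Real.norm_of_nonneg hT.le]
  refine div_le_div_of_nonneg_right ?_ hT.le
  rw [le_div_iff₀ hκ]
  linarith

end JumpMechanism

/-! ### Spreading among exchangeable receivers -/

/-- While `u` of the receivers are stale, each of them becomes fresh at rate `b u`. This is the
probability that a given one of `u` stale receivers becomes fresh before an independent
exponential clock of rate `lam` rings; it is computed by conditioning on the first event.
The value at `u = 0` is a convention, which the recursion multiplies by `0`. -/
noncomputable def reachProb (b : ℕ → ℝ) (lam : ℝ) : ℕ → ℝ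
  | 0 => 0
  | u + 1 => b (u + 1) * (1 + u * reachProb b lam u) / ((u + 1) * b (u + 1) + lam)

theorem reachProb_succ_mul {b : ℕ → ℝ} {lam : ℝ} (hlam : 0 < lam) {u : ℕ} (hb : 0 ≤ b (u + 1)) :
    reachProb b lam (u + 1) * ((u + 1) * b (u + 1) + lam) =
      b (u + 1) * (1 + u * reachProb b lam u) := by
  have : 0 < (u + 1) * b (u + 1) + lam := by positivity
  rw [reachProb, div_mul_cancel₀ _ this.ne']

theorem reachProb_mem_Icc {b : ℕ → ℝ} {lam : ℝ} (hlam : 0 < lam) {n : ℕ}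
    (hb : ∀ u ≤ n, 0 ≤ b u) : ∀ u ≤ n, reachProb b lam u ∈ Set.Icc (0 : ℝ) 1 := by
  intro u hu
  induction u with
  | zero => simp [reachProb]
  | succ u ih =>
    obtain ⟨h0, h1⟩ := ih (by omega)
    have hbu := hb _ hu
    rw [reachProb]
    refine ⟨by positivity, (div_le_one (by positivity)).2 ?_⟩
    nlinarith [mul_nonneg (mul_nonneg hbu u.cast_nonneg) (sub_nonneg.2 h1)]

/-- The recursion for `reachProb` as a generator equation: when one of the stale receivers `N`
becomes fresh, the probability for `i` jumps to `1` if it is `i` itself, and otherwise `i` is one of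
one fewer stale receivers. -/
theorem sum_reachProb {ι : Type*} [DecidableEq ι] {b : ℕ → ℝ} {lam : ℝ} (hlam : 0 < lam)
    {N : Finset ι} {i : ι} (hi : i ∈ N) (hb : 0 ≤ b N.card) :
    ∑ a ∈ N, b N.card * ((if a = i then 1 else reachProb b lam (N.card - 1)) -
      reachProb b lam N.card) = lam * reachProb b lam N.card := by
  obtain ⟨u, hu⟩ : ∃ u, N.card = u + 1 :=
    ⟨N.card - 1, (Nat.succ_pred_eq_of_pos (Finset.card_pos.2 ⟨i, hi⟩)).symm⟩
  have hrest : ∀ a ∈ N.erase i, b N.card * ((if a = i then 1 else reachProb b lam (N.card - 1)) -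
      reachProb b lam N.card) = b (u + 1) * (reachProb b lam u - reachProb b lam (u + 1)) := by
    intro a ha
    rw [if_neg (Finset.ne_of_mem_erase ha), hu, Nat.add_sub_cancel]
  rw [← Finset.add_sum_erase _ _ hi, Finset.sum_congr rfl hrest, Finset.sum_const,
    Finset.card_erase_of_mem hi, if_pos rfl, hu, nsmul_eq_mul, Nat.add_sub_cancel]
  rw [hu] at hb
  linarith [reachProb_succ_mul hlam hb]

theorem reachProb_const {a lam : ℝ} (ha : 0 ≤ a) (hlam : 0 < lam) (u : ℕ) :
    reachProb (fun _ => a) lam (u + 1) = a / (a + lam) := by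
  have h1 : 0 < a + lam := by positivity
  induction u with
  | zero => simp [reachProb]
  | succ u ih =>
    rw [reachProb, ih]
    have h2 : 0 < (((u + 1 : ℕ) : ℝ) + 1) * a + lam := by positivity
    field_simp
    push_cast
    ring

theorem mul_reachProb_div {c lam : ℝ} (hc : 0 ≤ c) (hlam : 0 < lam) (u : ℕ) :
    u * reachProb (fun v => c / v) lam u = c / lam * (1 - (c / (c + lam)) ^ u) := by
  have h1 : 0 < c + lam := by positivity
  induction u with
  | zero => simp
  | succ u ih =>
    have hu : ((u + 1 : ℕ) : ℝ) ≠ 0 := by positivity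
    have h3 : ((u : ℝ) + 1) * (c / ((u + 1 : ℕ) : ℝ)) = c := by push_cast at hu ⊢; field_simp
    rw [reachProb, ih, h3, pow_succ]
    field_simp
    ring

/-- The recursion of `reachProb` unrolled `n` times. The index `l` counts the receivers from the
first one to become fresh, so that `k + 1 - l` of them are stale at stage `l`. -/
theorem reachProb_eq_sum {b : ℕ → ℝ} {lam : ℝ} {k : ℕ} {β : ℕ → ℝ}
    (hβ : ∀ l ∈ Finset.Icc 1 k, b (k + 1 - l) = β l) (n : ℕ) (hn : n ≤ k) :
    reachProb b lam k = ∑ r ∈ Finset.Icc 1 n,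
        (∏ l ∈ Finset.Icc 1 (r - 1),
          (((k : ℝ) - l) * β l) / (((k : ℝ) - l + 1) * β l + lam)) *
          (β r / (((k : ℝ) - r + 1) * β r + lam)) +
      (∏ l ∈ Finset.Icc 1 n, (((k : ℝ) - l) * β l) / (((k : ℝ) - l + 1) * β l + lam)) *
        reachProb b lam (k - n) := by
  induction n with
  | zero => simp
  | succ n ih =>
    obtain ⟨u, rfl⟩ : ∃ u, k = n + 1 + u := ⟨k - (n + 1), by omega⟩
    have hb := hβ (n + 1) (by simp)
    rw [ih (by omega), Finset.sum_Icc_succ_top (by omega), Finset.prod_Icc_succ_top (by omega),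
      Nat.add_sub_cancel, Nat.add_sub_cancel_left, show n + 1 + u - n = u + 1 by omega, reachProb,
      ← hb, show n + 1 + u + 1 - (n + 1) = u + 1 by omega]
    push_cast
    ring

/-- The recursion unrolled for `k * reachProb k`, the expected number of receivers that become fresh
in time; `γ l` is the total rate at which stale receivers become fresh at stage `l`. -/
theorem mul_reachProb_eq_sum {b : ℕ → ℝ} {lam : ℝ} {k : ℕ} {γ : ℕ → ℝ}
    (hγ : ∀ l ∈ Finset.Icc 1 k, ((k : ℝ) + 1 - l) * b (k + 1 - l) = γ l) (n : ℕ) (hn : n ≤ k) :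
    k * reachProb b lam k = ∑ r ∈ Finset.Icc 1 n, ∏ l ∈ Finset.Icc 1 r, γ l / (γ l + lam) +
      (∏ l ∈ Finset.Icc 1 n, γ l / (γ l + lam)) * (((k : ℝ) - n) * reachProb b lam (k - n)) := by
  induction n with
  | zero => simp
  | succ n ih =>
    obtain ⟨u, rfl⟩ : ∃ u, k = n + 1 + u := ⟨k - (n + 1), by omega⟩
    have hb := hγ (n + 1) (by simp)
    rw [ih (by omega), Finset.sum_Icc_succ_top (by omega), Finset.prod_Icc_succ_top (by omega),
      Nat.add_sub_cancel_left, show n + 1 + u - n = u + 1 by omega, reachProb,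
      ← hb, show n + 1 + u + 1 - (n + 1) = u + 1 by omega]
    push_cast
    ring

/-! ### Stale sets under the events of the network -/

variable {m k : ℕ}

namespace NetState.Consistent

variable {x : NetState m k} (hx : x.Consistent)

theorem netAct (hx : x.Consistent) (e : NetEvent m k) : (netAct x e).Consistent := by
  obtain ⟨h1, h2⟩ := hx
  cases e with
  | selfUpdate => exact ⟨fun j => (h1 j).trans (Nat.le_succ _), h2⟩
  | toCH j =>
    refine ⟨fun j' => ?_, fun j' i => ?_⟩
    · rcases eq_or_ne j' j with rfl | h
      · simp [_root_.netAct, h1]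
      · simp [_root_.netAct, h, h1]
    · rcases eq_or_ne j' j with rfl | h
      · simp [_root_.netAct, h2]
      · simp [_root_.netAct, h, h2]
  | toNode j i =>
    refine ⟨h1, fun j' i' => ?_⟩
    rcases eq_or_ne j' j with rfl | h
    · rcases eq_or_ne i' i with rfl | h' <;> simp [_root_.netAct, setNode, *]
    · simp [_root_.netAct, setNode, h, h2]
  | gossip j a b =>
    refine ⟨h1, fun j' i' => ?_⟩
    rcases eq_or_ne j' j with rfl | h
    · rcases eq_or_ne i' b with rfl | h' <;> simp [_root_.netAct, setNode, *]
    · simp [_root_.netAct, setNode, h, h2]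

end NetState.Consistent

namespace NetState

theorem mem_staleCH {x : NetState m k} {j : Fin m} : j ∈ x.staleCH ↔ x.ch j ≠ x.src := by
  simp [staleCH]

theorem mem_staleNodes {x : NetState m k} {j : Fin m} {i : Fin k} :
    i ∈ x.staleNodes j ↔ x.node j i ≠ x.src := by simp [staleNodes]

theorem staleNodes_setNode_of_ne (x : NetState m k) {j j' : Fin m} (h : j ≠ j') (i : Fin k)
    (v : ℕ) : (setNode x j' i v).staleNodes j = x.staleNodes j := by
  ext a; simp [mem_staleNodes, setNode, h]

theorem staleNodes_setNode_of_fresh (x : NetState m k) (j : Fin m) (i : Fin k) {v : ℕ}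
    (hv : v = x.src) : (setNode x j i v).staleNodes j = (x.staleNodes j).erase i := by
  ext a
  rcases eq_or_ne a i with rfl | h <;> simp [mem_staleNodes, setNode, *]

theorem staleNodes_setNode_of_iff (x : NetState m k) (j : Fin m) (i : Fin k) {v : ℕ}
    (hv : v = x.src ↔ x.node j i = x.src) :
    (setNode x j i v).staleNodes j = x.staleNodes j := by
  ext a
  rcases eq_or_ne a i with rfl | h <;> simp [mem_staleNodes, setNode, *]

end NetState

namespace NetState.Consistent

variable {x : NetState m k} (hx : x.Consistent)

theorem node_le_src (hx : x.Consistent) (j : Fin m) (i : Fin k) : x.node j i ≤ x.src :=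
  (hx.2 j i).trans (hx.1 j)

theorem staleNodes_eq_univ (hx : x.Consistent) {j : Fin m} (hj : j ∈ x.staleCH) :
    x.staleNodes j = Finset.univ := by
  ext i
  have h1 := lt_of_le_of_ne (hx.1 j) (mem_staleCH.1 hj)
  simpa [mem_staleNodes] using ((hx.2 j i).trans_lt h1).ne

theorem staleCH_selfUpdate (hx : x.Consistent) :
    (_root_.netAct x .selfUpdate).staleCH = Finset.univ := by
  ext j
  simpa [mem_staleCH, _root_.netAct] using (Nat.lt_succ_of_le (hx.1 j)).ne

theorem staleNodes_selfUpdate (hx : x.Consistent) (j : Fin m) :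
    (_root_.netAct x .selfUpdate).staleNodes j = Finset.univ := by
  ext i
  simpa [mem_staleNodes, _root_.netAct] using (Nat.lt_succ_of_le (hx.node_le_src j i)).ne

theorem staleCH_toCH (hx : x.Consistent) (j : Fin m) :
    (_root_.netAct x (.toCH j)).staleCH = x.staleCH.erase j := by
  ext a
  have := hx.1 j
  rcases eq_or_ne a j with rfl | h <;> simp [mem_staleCH, _root_.netAct, *]

/-- A stale clusterhead holds an outdated version, and so cannot make a node fresh. -/
theorem staleNodes_toNode (hx : x.Consistent) (j : Fin m) (i : Fin k) :
    (_root_.netAct x (.toNode j i)).staleNodes j =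
      if j ∈ x.staleCH then x.staleNodes j else (x.staleNodes j).erase i := by
  have h1 := hx.1 j
  have h2 := hx.2 j i
  split_ifs with h <;> rw [mem_staleCH] at h
  · exact x.staleNodes_setNode_of_iff j i (by omega)
  · exact x.staleNodes_setNode_of_fresh j i (by omega)

theorem staleNodes_gossip (hx : x.Consistent) (j : Fin m) (a b : Fin k) :
    (_root_.netAct x (.gossip j a b)).staleNodes j =
      if a ∈ x.staleNodes j then x.staleNodes j else (x.staleNodes j).erase b := by
  have h1 := hx.node_le_src j a
  have h2 := hx.node_le_src j b
  split_ifs with h <;> rw [mem_staleNodes] at h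
  · exact x.staleNodes_setNode_of_iff j b (by omega)
  · exact x.staleNodes_setNode_of_fresh j b (by omega)

end NetState.Consistent

/-! ### Rates of the network -/

theorem sum_netEvent (f : NetEvent m k → ℝ) :
    ∑ e, f e = f .selfUpdate + ∑ j, f (.toCH j) + ∑ j, ∑ i, f (.toNode j i) +
      ∑ j, ∑ a, ∑ b, f (.gossip j a b) := by
  let φ : Unit ⊕ Fin m ⊕ (Fin m × Fin k) ⊕ (Fin m × Fin k × Fin k) ≃ NetEvent m k :=
    { toFun := fun
        | .inl _ => .selfUpdate
        | .inr (.inl j) => .toCH j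
        | .inr (.inr (.inl p)) => .toNode p.1 p.2
        | .inr (.inr (.inr p)) => .gossip p.1 p.2.1 p.2.2
      invFun := fun
        | .selfUpdate => .inl ()
        | .toCH j => .inr (.inl j)
        | .toNode j i => .inr (.inr (.inl (j, i)))
        | .gossip j a b => .inr (.inr (.inr (j, a, b)))
      left_inv := by rintro (_ | _ | _ | _) <;> rfl
      right_inv := by rintro (_ | _ | _ | _) <;> rfl }
  rw [← Equiv.sum_comp φ]
  simp only [Fintype.sum_sum_type, Fintype.sum_prod_type, Finset.univ_unique, Finset.sum_singleton,
    add_assoc]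
  rfl

theorem div_natCast_le_self {a : ℝ} (ha : 0 ≤ a) (n : ℕ) : a / n ≤ a := by
  rcases Nat.eq_zero_or_pos n with rfl | hn
  · simpa using ha
  · exact div_le_self ha (by exact_mod_cast hn)

theorem netRate_le (ρ : GossipRates) (S : SourceScheme) (C : ClusterScheme) (x : NetState m k)
    (e : NetEvent m k) : netRate ρ S C x e ≤ ρ.lamE + ρ.lamS + ρ.lamC + ρ.lamG := by
  have hE := ρ.lamE_pos.le
  have hS := ρ.lamS_nonneg
  have hC := ρ.lamC_nonneg
  have hG := ρ.lamG_nonneg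
  cases e with
  | selfUpdate => simp only [netRate]; linarith
  | toCH j =>
    cases S <;> simp only [netRate, rateToCH] <;> (try split_ifs) <;>
      linarith [div_natCast_le_self hS m, div_natCast_le_self hS x.staleCH.card]
  | toNode j i =>
    cases C <;> simp only [netRate, rateToNode] <;> (try split_ifs) <;>
      linarith [div_natCast_le_self hC k, div_natCast_le_self hC (x.staleNodes j).card]
  | gossip j a b =>
    -- division by a natural number does not increase the rate, even for `k = 1`, where `a / 0 = 0`
    have hk : (k : ℝ) - 1 = ((k - 1 : ℕ) : ℝ) := by rw [Nat.cast_sub a.pos]; simp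
    cases C <;> simp only [netRate, rateGossip, hk] <;> (try split_ifs) <;>
      linarith [div_natCast_le_self hG (k - 1), div_natCast_le_self hG (x.staleNodes j).card]

/-- Rate at which each of `u` stale clusterheads becomes fresh. -/
noncomputable def chRate (ρ : GossipRates) (m : ℕ) : SourceScheme → ℕ → ℝ
  | .noRC, _ => ρ.lamS / m
  | .RC, u => ρ.lamS / u

/-- Rate at which each of `u` stale nodes of a cluster with fresh clusterhead becomes fresh.
For `k = 1` the division by `k - 1 = 0` makes the gossip term of `noRC` vanish, as it should. -/
noncomputable def nodeRate (ρ : GossipRates) (k : ℕ) : ClusterScheme → ℕ → ℝ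
  | .noRC, u => ρ.lamC / k + ((k : ℝ) - u) * (ρ.lamG / ((k : ℝ) - 1))
  | .allRC, u => (ρ.lamC + ((k : ℝ) - u) * ρ.lamG) / u

theorem chRate_nonneg (ρ : GossipRates) (S : SourceScheme) (u : ℕ) : 0 ≤ chRate ρ m S u := by
  have := ρ.lamS_nonneg
  cases S <;> simp only [chRate] <;> positivity

theorem nodeRate_nonneg (ρ : GossipRates) (C : ClusterScheme) (hk : 0 < k) {u : ℕ} (hu : u ≤ k) :
    0 ≤ nodeRate ρ k C u := by
  have hC := ρ.lamC_nonneg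
  have hG := ρ.lamG_nonneg
  have h1 : (0 : ℝ) ≤ (k : ℝ) - u := sub_nonneg.2 (by exact_mod_cast hu)
  have h2 : (0 : ℝ) ≤ (k : ℝ) - 1 := sub_nonneg.2 (by exact_mod_cast hk)
  cases C <;> simp only [nodeRate] <;> positivity

theorem rateToCH_of_mem (ρ : GossipRates) (S : SourceScheme) {x : NetState m k} {j : Fin m}
    (hj : j ∈ x.staleCH) : rateToCH ρ S x j = chRate ρ m S x.staleCH.card := by
  cases S
  · rfl
  · exact if_pos (NetState.mem_staleCH.1 hj)

/-- The clusterhead and the `k - u` fresh nodes of a cluster together update each of its `u` stale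
nodes at rate `nodeRate u`. -/
theorem rateToNode_add_sum_rateGossip (ρ : GossipRates) (C : ClusterScheme) {x : NetState m k}
    {j : Fin m} {b : Fin k} (hb : b ∈ x.staleNodes j) :
    rateToNode ρ C x j b + ∑ a ∈ (x.staleNodes j)ᶜ, rateGossip ρ C x j a b =
      nodeRate ρ k C (x.staleNodes j).card := by
  have hcard : ((x.staleNodes j)ᶜ.card : ℝ) = (k : ℝ) - (x.staleNodes j).card := by
    rw [Finset.card_compl, Fintype.card_fin,
      Nat.cast_sub (by simpa using Finset.card_le_univ (x.staleNodes j))]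
  have hbs := NetState.mem_staleNodes.1 hb
  cases C with
  | noRC =>
    have h : ∀ a ∈ (x.staleNodes j)ᶜ, rateGossip ρ .noRC x j a b = ρ.lamG / ((k : ℝ) - 1) := by
      intro a ha
      have hab : a ≠ b := by rintro rfl; exact Finset.mem_compl.1 ha hb
      exact if_pos hab
    rw [Finset.sum_congr rfl h, Finset.sum_const, nsmul_eq_mul, hcard]
    rfl
  | allRC =>
    have h : ∀ a ∈ (x.staleNodes j)ᶜ, rateGossip ρ .allRC x j a b =
        ρ.lamG / (x.staleNodes j).card := by
      intro a ha
      refine if_pos ⟨?_, hbs⟩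
      simpa [NetState.mem_staleNodes] using ha
    have h' : rateToNode ρ .allRC x j b = ρ.lamC / (x.staleNodes j).card := if_pos hbs
    rw [Finset.sum_congr rfl h, Finset.sum_const, nsmul_eq_mul, hcard, h', nodeRate]
    ring

/-! ### The Poisson equation of the network -/

/-- Probability that node `i` of cluster `j` is fresh when the source generates its next version,
given the sets `A` of stale clusterheads and `N` of stale nodes of the cluster; `p u` and `f u` are
the probabilities to become fresh in time for one of `u` stale clusterheads, and for one of `u`
stale nodes below a fresh clusterhead. -/
noncomputable def freshValue (p f : ℕ → ℝ) (j : Fin m) (i : Fin k) (A : Finset (Fin m))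
    (N : Finset (Fin k)) : ℝ :=
  if i ∉ N then 1 else if j ∉ A then f N.card else p A.card * f k

theorem abs_freshValue_le {p f : ℕ → ℝ} (hp : ∀ u ≤ m, p u ∈ Set.Icc (0 : ℝ) 1)
    (hf : ∀ u ≤ k, f u ∈ Set.Icc (0 : ℝ) 1) (j : Fin m) (i : Fin k) (A : Finset (Fin m))
    (N : Finset (Fin k)) : |freshValue p f j i A N| ≤ 1 := by
  have hA := hp A.card (by simpa using A.card_le_univ)
  have hN := hf N.card (by simpa using N.card_le_univ)
  have hk := hf k le_rfl
  unfold freshValue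
  split_ifs
  · rw [abs_of_nonneg (mul_nonneg hA.1 hk.1)]; exact mul_le_one₀ hA.2 hk.1 hk.2
  · rw [abs_of_nonneg hN.1]; exact hN.2
  · simp

/-- The probability `G` to be fresh at the next source update solves the Poisson equation
`L G = lamE * (c - F)` on the consistent states, where `c = p m * f k` is the value of `G` when
everything is stale. -/
theorem poisson_network (ρ : GossipRates) (S : SourceScheme) (C : ClusterScheme)
    {x : NetState m k} (hx : x.Consistent) (j : Fin m) (i : Fin k) :
    let p := reachProb (chRate ρ m S) ρ.lamE
    let f := reachProb (nodeRate ρ k C) ρ.lamE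
    let G := fun y : NetState m k => freshValue p f j i y.staleCH (y.staleNodes j)
    ∑ e, netRate ρ S C x e * (G (netAct x e) - G x) = ρ.lamE * (p m * f k - x.fresh j i) := by
  intro p f G
  set A := x.staleCH with hA
  set N := x.staleNodes j with hN
  have hGx : G x = freshValue p f j i A N := rfl
  have hself : G (netAct x .selfUpdate) = p m * f k := by
    simp [G, hx.staleCH_selfUpdate, hx.staleNodes_selfUpdate, freshValue]
  have hCH : ∀ j', G (netAct x (.toCH j')) = freshValue p f j i (A.erase j') N := by
    intro j'
    simp only [G, hx.staleCH_toCH]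
    rfl
  have hnode : ∀ b, G (netAct x (.toNode j b)) =
      freshValue p f j i A (if j ∈ A then N else N.erase b) := by
    intro b
    simp only [G, hx.staleNodes_toNode]
    rfl
  have hnode' : ∀ j' ≠ j, ∀ b, G (netAct x (.toNode j' b)) = G x := by
    intro j' hj' b
    simp only [G, netAct, x.staleNodes_setNode_of_ne hj'.symm]
    rfl
  have hgossip : ∀ a b, G (netAct x (.gossip j a b)) =
      freshValue p f j i A (if a ∈ N then N else N.erase b) := by
    intro a b
    simp only [G, hx.staleNodes_gossip]
    rfl
  have hgossip' : ∀ j' ≠ j, ∀ a b, G (netAct x (.gossip j' a b)) = G x := by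
    intro j' hj' a b
    simp only [G, netAct, x.staleNodes_setNode_of_ne hj'.symm]
    rfl
  -- the events inside the other clusters leave `G` unchanged
  have hsnode : ∑ j', ∑ b, netRate ρ S C x (.toNode j' b) * (G (netAct x (.toNode j' b)) - G x) =
      ∑ b, netRate ρ S C x (.toNode j b) * (G (netAct x (.toNode j b)) - G x) :=
    Finset.sum_eq_single_of_mem j (Finset.mem_univ j) fun j' _ hj' => by simp [hnode' j' hj']
  have hsgossip : ∑ j', ∑ a, ∑ b, netRate ρ S C x (.gossip j' a b) *
        (G (netAct x (.gossip j' a b)) - G x) =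
      ∑ a, ∑ b, netRate ρ S C x (.gossip j a b) * (G (netAct x (.gossip j a b)) - G x) :=
    Finset.sum_eq_single_of_mem j (Finset.mem_univ j) fun j' _ hj' => by simp [hgossip' j' hj']
  rw [sum_netEvent, hsnode, hsgossip]
  simp only [hself, hCH, hnode, hgossip, hGx, netRate]
  have hfresh : x.fresh j i = if i ∈ N then 0 else 1 := by
    simp [NetState.fresh, hN, NetState.mem_staleNodes]
  rw [hfresh]
  by_cases hi : i ∈ N
  · by_cases hj : j ∈ A
    · -- stale clusterhead: all nodes of the cluster are stale and stay so
      have hNu : N = Finset.univ := hx.staleNodes_eq_univ hj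
      have hval : freshValue p f j i A N = p A.card * f k := by simp [freshValue, hi, hj]
      have hsum : ∑ j', rateToCH ρ S x j' *
          (freshValue p f j i (A.erase j') N - freshValue p f j i A N) =
          (∑ a ∈ A, chRate ρ m S A.card *
            ((if a = j then 1 else p (A.card - 1)) - p A.card)) * f k := by
        rw [Finset.sum_mul, ← Finset.sum_subset A.subset_univ]
        · refine Finset.sum_congr rfl fun a ha => ?_
          rw [rateToCH_of_mem ρ S ha, hval]
          by_cases haj : a = j
          · subst haj; simp [freshValue, hNu]; ring
          · simp [freshValue, hi, hj, haj, Ne.symm haj, Finset.card_erase_of_mem ha]; ring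
        · intro a _ ha
          simp [Finset.erase_eq_of_notMem ha]
      rw [hsum, sum_reachProb ρ.lamE_pos hj (chRate_nonneg ρ S _), hval]
      simp only [hj, hNu, if_true, Finset.mem_univ]
      rw [← hNu, hval]
      simp
      ring
    · -- fresh clusterhead, stale node
      have hval : freshValue p f j i A N = f N.card := by simp [freshValue, hi, hj]
      have hk : 0 < k := i.pos
      have hCHzero : ∀ j', freshValue p f j i (A.erase j') N = f N.card := by
        intro j'; simp [freshValue, hi, hj]
      have hsum : ∑ b, rateToNode ρ C x j b * (freshValue p f j i A (N.erase b) - f N.card) +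
          ∑ a, ∑ b, rateGossip ρ C x j a b *
            (freshValue p f j i A (if a ∈ N then N else N.erase b) - f N.card) =
          ∑ b ∈ N, nodeRate ρ k C N.card * ((if b = i then 1 else f (N.card - 1)) - f N.card) := by
        have hin : ∑ a, ∑ b, rateGossip ρ C x j a b *
            (freshValue p f j i A (if a ∈ N then N else N.erase b) - f N.card) =
            ∑ a ∈ Nᶜ, ∑ b, rateGossip ρ C x j a b *
              (freshValue p f j i A (N.erase b) - f N.card) := by
          rw [← Finset.sum_subset (Nᶜ).subset_univ]
          · refine Finset.sum_congr rfl fun a ha => ?_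
            simp only [if_neg (Finset.mem_compl.1 ha)]
          · intro a _ ha
            simp [show a ∈ N by simpa using ha, hval]
        rw [hin, Finset.sum_comm, ← Finset.sum_add_distrib, ← Finset.sum_subset N.subset_univ]
        · refine Finset.sum_congr rfl fun b hb => ?_
          rw [← Finset.sum_mul, ← add_mul, rateToNode_add_sum_rateGossip ρ C hb]
          congr 2
          by_cases hbi : b = i
          · subst hbi; simp [freshValue]
          · simp [freshValue, hi, hj, hbi, Ne.symm hbi, Finset.card_erase_of_mem hb]
        · intro b _ hb
          simp [Finset.erase_eq_of_notMem hb, hval]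
      simp only [hval, hCHzero, hj, if_false, sub_self, mul_zero, Finset.sum_const_zero, add_zero,
        hi, if_true]
      rw [add_assoc, hsum, sum_reachProb ρ.lamE_pos hi
        (nodeRate_nonneg ρ C hk (by simpa using N.card_le_univ))]
      ring
  · -- a fresh node stays fresh until the next version
    have hV : ∀ (A' : Finset (Fin m)) (N' : Finset (Fin k)), N' ⊆ N →
        freshValue p f j i A' N' = 1 := by
      intro A' N' h
      rw [freshValue, if_pos fun h' => hi (h h')]
    have h1 : ∀ b, freshValue p f j i A (if j ∈ A then N else N.erase b) = 1 := fun b =>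
      hV _ _ (by split_ifs; exacts [subset_rfl, Finset.erase_subset _ _])
    have h2 : ∀ a b, freshValue p f j i A (if a ∈ N then N else N.erase b) = 1 := fun a b =>
      hV _ _ (by split_ifs; exacts [subset_rfl, Finset.erase_subset _ _])
    simp [h1, h2, hV _ N subset_rfl, hi]

/-- The long-term average freshness is the probability that the clusterhead becomes fresh before the
next source update, times the same probability for a node below a fresh clusterhead. -/
theorem avgFreshness_eq (ρ : GossipRates) (S : SourceScheme) (C : ClusterScheme)
    {x₀ : NetState m k} (hx₀ : x₀.Consistent) (j : Fin m) (i : Fin k) :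
    avgFreshness ρ S C x₀ j i =
      reachProb (chRate ρ m S) ρ.lamE m * reachProb (nodeRate ρ k C) ρ.lamE k := by
  have hQ : ∀ x, (network m k ρ S C).totalRate x ≤
      (Fintype.card (NetEvent m k)) • (ρ.lamE + ρ.lamS + ρ.lamC + ρ.lamG) := fun x =>
    Finset.sum_le_card_nsmul _ _ _ fun e _ => netRate_le ρ S C x e
  have hF : ∀ x : NetState m k, |x.fresh j i| ≤ 1 := fun x => by
    unfold NetState.fresh; split_ifs <;> simp
  have hG : ∀ x : NetState m k, |freshValue (reachProb (chRate ρ m S) ρ.lamE)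
      (reachProb (nodeRate ρ k C) ρ.lamE) j i x.staleCH (x.staleNodes j)| ≤ 1 := fun x =>
    abs_freshValue_le (reachProb_mem_Icc ρ.lamE_pos fun u _ => chRate_nonneg ρ S u)
      (reachProb_mem_Icc ρ.lamE_pos fun u hu => nodeRate_nonneg ρ C i.pos hu) j i _ _
  have h := JumpMechanism.tendsto_average_of_poisson hQ (C := {x | x.Consistent})
    (fun x hx e => NetState.Consistent.netAct hx e) hx₀ hF hG ρ.lamE_pos
    fun x hx => poisson_network ρ S C hx j i
  exact h.limsup_eq

/-! ### Closed forms -/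

theorem reachProb_chRate_noRC (ρ : GossipRates) (hm : 0 < m) :
    reachProb (chRate ρ m .noRC) ρ.lamE m = ρ.lamS / (ρ.lamS + m * ρ.lamE) := by
  have hE := ρ.lamE_pos
  have hS := ρ.lamS_nonneg
  obtain ⟨u, rfl⟩ : ∃ u, m = u + 1 := ⟨m - 1, by omega⟩
  have h := reachProb_const (a := ρ.lamS / ((u + 1 : ℕ) : ℝ)) (by positivity) hE u
  refine h.trans ?_
  have : 0 < ρ.lamS + ((u + 1 : ℕ) : ℝ) * ρ.lamE := by positivity
  field_simp

theorem reachProb_chRate_RC (ρ : GossipRates) (hm : 0 < m) :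
    reachProb (chRate ρ m .RC) ρ.lamE m =
      1 / m * (ρ.lamS / ρ.lamE) * (1 - (ρ.lamS / (ρ.lamS + ρ.lamE)) ^ m) := by
  have h : (m : ℝ) * reachProb (chRate ρ m .RC) ρ.lamE m = _ :=
    mul_reachProb_div ρ.lamS_nonneg ρ.lamE_pos m
  have hm' : (m : ℝ) ≠ 0 := by positivity
  rw [mul_assoc, ← h]
  field_simp

theorem reachProb_nodeRate_noRC (ρ : GossipRates) (k : ℕ) :
    reachProb (nodeRate ρ k .noRC) ρ.lamE k =
      ∑ r ∈ Finset.Icc 1 k,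
        (∏ l ∈ Finset.Icc 1 (r - 1),
          (((k : ℝ) - l) * (ρ.lamC / k + ((l : ℝ) - 1) * (ρ.lamG / ((k : ℝ) - 1)))) /
            (((k : ℝ) - l + 1) * (ρ.lamC / k + ((l : ℝ) - 1) * (ρ.lamG / ((k : ℝ) - 1)))
              + ρ.lamE)) *
        ((ρ.lamC / k + ((r : ℝ) - 1) * (ρ.lamG / ((k : ℝ) - 1))) /
          (((k : ℝ) - r + 1) * (ρ.lamC / k + ((r : ℝ) - 1) * (ρ.lamG / ((k : ℝ) - 1)))
            + ρ.lamE)) := by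
  rw [reachProb_eq_sum
    (β := fun l => ρ.lamC / k + ((l : ℝ) - 1) * (ρ.lamG / ((k : ℝ) - 1))) ?_ k le_rfl]
  · simp [reachProb]
  · intro l hl
    rw [Finset.mem_Icc] at hl
    rw [nodeRate, Nat.cast_sub (by omega)]
    push_cast
    ring

theorem reachProb_nodeRate_allRC (ρ : GossipRates) (hk : 0 < k) :
    reachProb (nodeRate ρ k .allRC) ρ.lamE k =
      1 / k * ∑ r ∈ Finset.Icc 1 k, ∏ l ∈ Finset.Icc 1 r,
        (ρ.lamC + ((l : ℝ) - 1) * ρ.lamG) / (ρ.lamC + ((l : ℝ) - 1) * ρ.lamG + ρ.lamE) := by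
  have h := mul_reachProb_eq_sum (b := nodeRate ρ k .allRC) (lam := ρ.lamE)
    (γ := fun l => ρ.lamC + ((l : ℝ) - 1) * ρ.lamG) ?_ k le_rfl
  · rw [sub_self, zero_mul, mul_zero, add_zero] at h
    have hk' : (k : ℝ) ≠ 0 := by positivity
    rw [← h]
    field_simp
  · intro l hl
    rw [Finset.mem_Icc] at hl
    have hne : (k : ℝ) + 1 - l ≠ 0 := by
      have : (l : ℝ) ≤ k := by exact_mod_cast hl.2
      linarith
    rw [nodeRate, Nat.cast_sub (by omega)]
    push_cast
    field_simp
    ring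

theorem mainTheorem4 (m k : ℕ) (ρ : GossipRates) (x₀ : NetState m k) (hx₀ : x₀.Consistent)
    (j : Fin m) (i : Fin k) :
    avgFreshness ρ .noRC .noRC x₀ j i =
        ρ.lamS / (ρ.lamS + m * ρ.lamE) *
          ∑ r ∈ Finset.Icc 1 k,
            (∏ l ∈ Finset.Icc 1 (r - 1),
              (((k : ℝ) - l) * (ρ.lamC / k + ((l : ℝ) - 1) * (ρ.lamG / ((k : ℝ) - 1)))) /
                (((k : ℝ) - l + 1) * (ρ.lamC / k + ((l : ℝ) - 1) * (ρ.lamG / ((k : ℝ) - 1)))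
                  + ρ.lamE)) *
            ((ρ.lamC / k + ((r : ℝ) - 1) * (ρ.lamG / ((k : ℝ) - 1))) /
              (((k : ℝ) - r + 1) * (ρ.lamC / k + ((r : ℝ) - 1) * (ρ.lamG / ((k : ℝ) - 1)))
                + ρ.lamE)) ∧
    avgFreshness ρ .RC .noRC x₀ j i =
        1 / m * (ρ.lamS / ρ.lamE) * (1 - (ρ.lamS / (ρ.lamS + ρ.lamE)) ^ m) *
          ∑ r ∈ Finset.Icc 1 k,
            (∏ l ∈ Finset.Icc 1 (r - 1),
              (((k : ℝ) - l) * (ρ.lamC / k + ((l : ℝ) - 1) * (ρ.lamG / ((k : ℝ) - 1)))) /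
                (((k : ℝ) - l + 1) * (ρ.lamC / k + ((l : ℝ) - 1) * (ρ.lamG / ((k : ℝ) - 1)))
                  + ρ.lamE)) *
            ((ρ.lamC / k + ((r : ℝ) - 1) * (ρ.lamG / ((k : ℝ) - 1))) /
              (((k : ℝ) - r + 1) * (ρ.lamC / k + ((r : ℝ) - 1) * (ρ.lamG / ((k : ℝ) - 1)))
                + ρ.lamE)) ∧
    avgFreshness ρ .RC .allRC x₀ j i =
        1 / m * (ρ.lamS / ρ.lamE) * (1 - (ρ.lamS / (ρ.lamS + ρ.lamE)) ^ m) *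
          (1 / k * ∑ r ∈ Finset.Icc 1 k,
            ∏ l ∈ Finset.Icc 1 r,
              (ρ.lamC + ((l : ℝ) - 1) * ρ.lamG) /
                (ρ.lamC + ((l : ℝ) - 1) * ρ.lamG + ρ.lamE)) := by
  rw [avgFreshness_eq _ _ _ hx₀, avgFreshness_eq _ _ _ hx₀, avgFreshness_eq _ _ _ hx₀,
    reachProb_chRate_noRC ρ j.pos, reachProb_chRate_RC ρ j.pos, reachProb_nodeRate_noRC,
    reachProb_nodeRate_allRC ρ i.pos]
  exact ⟨rfl, rfl, rfl⟩
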